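/- Let $s,N\ge 0$ be integers, let $G=(V,E)$ be the directed graph with $V=\{-N-2,\dots,0\}^s$ and $E=\{(\beta,\beta-\epsilon_\ell):\beta\in\{-N-1,\dots,0\}^s,\ 1\le\ell\le s\}$ ($\epsilon_\ell$ the standard unit vectors), let $\bar E=E\cup\{(v,u):(u,v)\in E\}$ and $n=|V|$. For $d:E\to\mathbb R$ put $b^d_v=\sum_{u:(v,u)\in E}d_{vu}-\sum_{u:(u,v)\in E}d_{uv}$ for $v\in V$, and consider - Flow($d$): minimize $\sum_{(u,v)\in\bar E}f_{uv}$ over $f:\bar E\to\mathbb R$ subject to $f\ge 0$ and $\sum_{u:(v,u)\in\bar E}f_{vu}-\sum_{u:(u,v)\in\bar E}f_{uv}=b^d_v$ for all $v\in V$; - DualFlow($d$): maximize $\sum_{v\in V}b^d_v x_v$ over $x:V\to\mathbb R$ subject to $x_v-x_u\le 1$ for all $(u,v)\in\bar E$. **Flow algorithm (successive shortest paths).** Input: $d:E\to\mathbb Z$. (1) Compute $b^d$; set $\varepsilon:=b^d$, $f:=0$, $\pi:=0$, $\mathcal E_+:=\{v:\varepsilon(v)>0\}$, $\mathcal E_-:=\{v:\varepsilon(v)<0\}$.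 (2) While $\mathcal E_+\neq\emptyset$: choose any $v_+\in\mathcal E_+$, $v_-\in\mathcal E_-$. In the residual network, which has an arc from $u$ to $v$ of infinite capacity and reduced cost $1-\pi(u)+\pi(v)$ for each $(u,v)\in\bar E$, and a backward arc from $u$ to $v$ of capacity $f_{vu}$ and reduced cost $-1-\pi(u)+\pi(v)$ for each $(v,u)\in\bar E$ with $f_{vu}>0$, compute by Dijkstra's algorithm, with the reduced costs as lengths, the distances $\delta(v)$ from $v_+$ to all $v$ and a shortest path $P$ from $v_+$ to $v_-$. Replace $\pi(v)$ by $\pi(v)-\delta(v)$ for all $v$ with $\delta(v)<\infty$. Let $\gamma$ be the minimum of $\varepsilon(v_+)$, $-\varepsilon(v_-)$ and the residual capacities on $P$. Augment $f$ by $\gamma$ along $P$ (an arc of $P$ from $u$ to $v$ increases $f_{uv}$ by $\gamma$, a backward arc from $u$ to $v$ decreases $f_{vu}$ by $\gamma$), decrease $\varepsilon(v_+)$ by $\gamma$, increase $\varepsilon(v_-)$ by $\gamma$, and update $\mathcal E_\pm$. Output: $f^*:=f$ and $x^*:=\pi$. Running times count elementary operations (array accesses, arithmetic operations, comparisons, list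 operations, passes through loops) at unit cost. Dijkstra's algorithm is the version with arrays, which scans the vertices in an arbitrary fixed order. **Theorem.** (a) In a finite graph with $n$ vertices and nonnegative arc costs (in any linearly ordered abelian group), Dijkstra's algorithm computes, in $O(n^2)$ steps, the distances from a given vertex $s$ to all vertices and, for a given $t$ that can be reached from $s$, a shortest path from $s$ to $t$. (b) Let $d:E\to\mathbb Z$ and $B=\frac12\sum_{v\in V}|b^d_v|$. For every order of the vertices and all choices of $v_+$ and $v_-$: as long as $\mathcal E_+\ne\emptyset$ another iteration can be made; there are at most $B$ iterations; the total number of steps is at most $C\max\{B,1\}\,n^2$ with an absolute constant $C$, i.e. $O(Bn^2)$ unless $B=0$; and when the algorithm stops, $f^*$ (which is integral) is an optimal solution of Flow($d$) and $x^*$ is an optimal solution of DualFlow($d$). -/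

import Mathlib

namespace SubdivisionFlow

/-! ## Step counting

A unit-cost random access machine, shallowly embedded: a computation has a result and a number of
elementary steps. Steps are charged by the primitives below (one array access, one arithmetic
operation, one comparison, one list operation, one pass through a loop: one step each). Every
algorithm below is composed of these primitives by `pure`, `>>=` and branching on results that
have already been charged. Arrays are functions on their finite index set; each of them is
used linearly, so that an update can be done in place. -/

/-- A computation with result `val` that takes `time` steps. -/
structure TimeM (α : Type) where
  val : α
  time : ℕ

instance : Monad TimeM where
  pure a := ⟨a, 0⟩
  bind m k := ⟨(k m.val).val, m.time + (k m.val).time⟩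

/-- One step without result. -/
def tick : TimeM Unit := ⟨(), 1⟩

/-- Read an array cell. -/
def rd {ι β : Type} (a : ι → β) (i : ι) : TimeM β := ⟨a i, 1⟩

/-- Write an array cell. -/
def wr {ι β : Type} [DecidableEq ι] (a : ι → β) (i : ι) (x : β) : TimeM (ι → β) :=
  ⟨Function.update a i x, 1⟩

/-- Allocate an array and fill it with `x`: one step for each cell. -/
def newArray (ι : Type) {β : Type} [Fintype ι] (x : β) : TimeM (ι → β) :=
  ⟨fun _ => x, Fintype.card ι⟩

/-- Addition. -/
def add {R : Type} [Add R] (x y : R) : TimeM R := ⟨x + y, 1⟩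

/-- Subtraction. -/
def sub {R : Type} [Sub R] (x y : R) : TimeM R := ⟨x - y, 1⟩

/-- Minimum. -/
def minimum {R : Type} [LinearOrder R] (x y : R) : TimeM R := ⟨min x y, 1⟩

/-- Comparison. -/
def less {R : Type} [LinearOrder R] (x y : R) : TimeM Bool := ⟨decide (x < y), 1⟩

/-- Equality test. -/
def equal {α : Type} [DecidableEq α] (x y : α) : TimeM Bool := ⟨decide (x = y), 1⟩

/-- Put an element at the front of a list. -/
def push {α : Type} (x : α) (l : List α) : TimeM (List α) := ⟨x :: l, 1⟩

/-- The loop `for i in l do s := body i s`, with one step of overhead for each pass. -/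
def forEach {ι σ : Type} : List ι → σ → (ι → σ → TimeM σ) → TimeM σ
  | [], s, _ => pure s
  | i :: l, s, body => do
      tick
      let s' ← body i s
      forEach l s' body

/-! ## Dijkstra's algorithm -/

section Dijkstra

variable {V R : Type}

/-- `IsWalk s t P`: the list of arcs `P` is a walk from `s` to `t`. -/
inductive IsWalk : V → V → List (V × V) → Prop
  | nil (v : V) : IsWalk v v []
  | cons {u v t : V} {P : List (V × V)} : IsWalk v t P → IsWalk u t ((u, v) :: P)

/-- `c` is the distance from `s` to `t` for the arc lengths `w`, where `⊤` means that there is no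
arc (so that the distance is `⊤` if `t` cannot be reached from `s`). -/
def IsDistance [AddCommMonoid R] [LinearOrder R] (w : V × V → WithTop R) (s t : V)
    (c : WithTop R) : Prop :=
  IsLeast {x | ∃ P, IsWalk s t P ∧ (P.map w).sum = x} c

/-- The tentative distances, the predecessors, and the set of settled vertices. -/
structure DijkstraState (V R : Type) where
  dist : V → WithTop R
  pred : V → Option V
  settled : V → Bool

/-- An unsettled vertex of least tentative distance, found by a scan of all vertices. -/
def selectMin [LinearOrder R] (vs : List V) (D : DijkstraState V R) : TimeM (Option V) :=
  forEach vs none fun v best => do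
    let b ← rd D.settled v
    if b then pure best
    else match best with
      | none => pure (some v)
      | some u => do
          let dv ← rd D.dist v
          let du ← rd D.dist u
          let c ← less dv du
          if c then pure (some v) else pure best

/-- Relax all arcs that leave `u`. -/
def relax [DecidableEq V] [AddCommMonoid R] [LinearOrder R] (vs : List V)
    (w : V × V → WithTop R) (u : V) (D : DijkstraState V R) : TimeM (DijkstraState V R) :=
  forEach vs D fun v D => do
    let du ← rd D.dist u
    let l ← rd w (u, v)
    let c ← add du l
    let dv ← rd D.dist v
    let b ← less c dv
    if b then
      let dist ← wr D.dist v c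
      let pred ← wr D.pred v (some u)
      pure { D with dist := dist, pred := pred }
    else pure D

/-- Follow the predecessors from `t` back to `s`; the result is the list of the arcs passed, in
the order from `s` to `t`. -/
def tracePath [DecidableEq V] (vs : List V) (pred : V → Option V) (s t : V) :
    TimeM (List (V × V)) := do
  let r ← forEach vs (t, ([] : List (V × V))) fun _ r => do
    let b ← equal r.1 s
    if b then pure r
    else do
      let p ← rd pred r.1
      match p with
      | none => pure r
      | some u => do
          let P ← push (u, r.1) r.2
          pure (u, P)
  pure r.2

/-- Dijkstra's algorithm with arrays. `vs` lists the vertices in the order in which they are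
scanned, `w` is the matrix of arc lengths (`⊤`: no arc). The result consists of the array of
the distances from `s` and of a path from `s` to `t`. -/
def dijkstra [Fintype V] [DecidableEq V] [AddCommMonoid R] [LinearOrder R] (vs : List V)
    (w : V × V → WithTop R) (s t : V) : TimeM ((V → WithTop R) × List (V × V)) := do
  let dist₀ ← newArray V (⊤ : WithTop R)
  let dist₁ ← wr dist₀ s 0
  let pred₀ ← newArray V (none : Option V)
  let settled₀ ← newArray V false
  let D ← forEach vs (⟨dist₁, pred₀, settled₀⟩ : DijkstraState V R) fun _ D => do
    let m ← selectMin vs D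
    match m with
    | none => pure D
    | some u => do
        let settled ← wr D.settled u true
        relax vs w u { D with settled := settled }
  let P ← tracePath vs D.pred s t
  pure (D.dist, P)

end Dijkstra

/-! ## The two optimization problems -/

section Problems

variable {V : Type} [Fintype V] (G : Digraph V) [DecidableRel G.Adj]

/-- `(u, v)` is an edge of the symmetric graph, which has the edges of `G` and their reversals. -/
def SymAdj (u v : V) : Prop := G.Adj u v ∨ G.Adj v u

instance : DecidableRel (SymAdj G) := fun u v =>
  inferInstanceAs (Decidable (G.Adj u v ∨ G.Adj v u))

/-- The weight `b^d_v`. Only the values of `d` on the edges of `G` matter. -/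
def supply {R : Type} [AddCommGroup R] (d : V × V → R) (v : V) : R :=
  (∑ u with G.Adj v u, d (v, u)) - ∑ u with G.Adj u v, d (u, v)

/-- Feasibility in `Flow(d)`. Only the values of `f` on the edges of the symmetric graph matter. -/
def IsFeasibleFlow (d f : V × V → ℝ) : Prop :=
  (∀ v, (∑ u with SymAdj G v u, f (v, u)) - (∑ u with SymAdj G u v, f (u, v)) = supply G d v) ∧
    ∀ u v, SymAdj G u v → 0 ≤ f (u, v)

/-- The objective function of `Flow(d)`. -/
def flowCost (f : V × V → ℝ) : ℝ := ∑ e : V × V with SymAdj G e.1 e.2, f e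

/-- `f` is an optimal solution of `Flow(d)`. -/
def IsOptimalFlow (d f : V × V → ℝ) : Prop :=
  IsFeasibleFlow G d f ∧ ∀ g, IsFeasibleFlow G d g → flowCost G f ≤ flowCost G g

/-- Feasibility in `DualFlow(d)`. -/
def IsFeasibleDual (x : V → ℝ) : Prop := ∀ u v, SymAdj G u v → x v - x u ≤ 1

/-- The objective function of `DualFlow(d)`. -/
def dualValue (d : V × V → ℝ) (x : V → ℝ) : ℝ := ∑ v, supply G d v * x v

/-- `x` is an optimal solution of `DualFlow(d)`. -/
def IsOptimalDual (d : V × V → ℝ) (x : V → ℝ) : Prop :=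
  IsFeasibleDual G x ∧ ∀ y, IsFeasibleDual G y → dualValue G d y ≤ dualValue G d x

/-- The adjacency matrix of `G`, an input of the algorithm. -/
def adjMatrix (p : V × V) : Bool := decide (G.Adj p.1 p.2)

end Problems

/-! ## The flow algorithm -/

section Algorithm

variable {V : Type}

/-- The variables of the algorithm: the flow `f`, the potential `pot`, the remaining supply
`exc`, and the lists of the vertices at which `exc` is positive and negative. -/
structure FlowState (V : Type) where
  f : V × V → ℤ
  pot : V → ℤ
  exc : V → ℤ
  excPos : List V
  excNeg : List V

/-- Compute the array of the weights `b^d_v`. -/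
def computeSupply [Fintype V] [DecidableEq V] (vs : List V) (A : V × V → Bool) (d : V × V → ℤ) :
    TimeM (V → ℤ) := do
  let b₀ ← newArray V (0 : ℤ)
  forEach vs b₀ fun v b =>
    forEach vs b fun u b => do
      let out ← rd A (v, u)
      let b ← if out then do
          let x ← rd b v
          let y ← rd d (v, u)
          let z ← add x y
          wr b v z
        else pure b
      let inn ← rd A (u, v)
      if inn then do
        let x ← rd b v
        let y ← rd d (u, v)
        let z ← sub x y
        wr b v z
      else pure b

/-- The lists of the vertices at which `exc` is positive and negative. -/
def signLists (vs : List V) (exc : V → ℤ) : TimeM (List V × List V) :=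
  forEach vs (([], []) : List V × List V) fun v r => do
    let x ← rd exc v
    let p ← less 0 x
    let q ← less x 0
    if p then do
      let l ← push v r.1
      pure (l, r.2)
    else if q then do
      let l ← push v r.2
      pure (r.1, l)
    else pure r

/-- The initial step, with the first evaluation of the loop condition. -/
def initialStep [Fintype V] [DecidableEq V] (vs : List V) (A : V × V → Bool) (d : V × V → ℤ) :
    TimeM (FlowState V) := do
  let exc ← computeSupply vs A d
  let r ← signLists vs exc
  let f ← newArray (V × V) (0 : ℤ)
  let pot ← newArray V (0 : ℤ)
  tick
  pure ⟨f, pot, exc, r.1, r.2⟩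

/-- The reduced costs of the residual network, as a matrix of arc lengths. From `u` to `v` there
is an arc of reduced cost `1 - pot u + pot v` and infinite capacity if `(u, v)` is an edge of the
symmetric graph, and a backward arc of reduced cost `-1 - pot u + pot v` and capacity `f (v, u)`
if `f (v, u) > 0`. If both are present, then the matrix contains the shorter one, the
backward arc: the other one is on no shortest path. -/
def residualLengths [Fintype V] [DecidableEq V] (vs : List V) (A : V × V → Bool)
    (f : V × V → ℤ) (pot : V → ℤ) : TimeM (V × V → WithTop ℤ) := do
  let w₀ ← newArray (V × V) (⊤ : WithTop ℤ)
  forEach vs w₀ fun u w =>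
    forEach vs w fun v w => do
      let pu ← rd pot u
      let pv ← rd pot v
      let a ← rd A (u, v)
      let a' ← rd A (v, u)
      let w ← if a || a' then do
          let x ← sub 1 pu
          let c ← add x pv
          wr w (u, v) (c : WithTop ℤ)
        else pure w
      let y ← rd f (v, u)
      let back ← less 0 y
      if back then do
        let x ← sub (-1) pu
        let c ← add x pv
        wr w (u, v) (c : WithTop ℤ)
      else pure w

/-- `pot := pot - δ`; vertices at infinite distance keep their potential. -/
def updatePotential [DecidableEq V] (vs : List V) (pot : V → ℤ) (δ : V → WithTop ℤ) :
    TimeM (V → ℤ) :=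
  forEach vs pot fun v pot => do
    let x ← rd δ v
    match x with
    | none => pure pot
    | some c => do
        let y ← rd pot v
        let z ← sub y c
        wr pot v z

/-- The minimum of `γ₀` and the residual capacities on `P`; only backward arcs have a finite
one. -/
def bottleneck (P : List (V × V)) (f : V × V → ℤ) (γ₀ : ℤ) : TimeM ℤ :=
  forEach P γ₀ fun e γ => do
    let y ← rd f (e.2, e.1)
    let back ← less 0 y
    if back then minimum γ y else pure γ

/-- Send `γ` units along `P`: a backward arc from `u` to `v` decreases `f (v, u)`, any other arc
increases `f (u, v)`. -/
def augment [DecidableEq V] (P : List (V × V)) (γ : ℤ) (f : V × V → ℤ) : TimeM (V × V → ℤ) :=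
  forEach P f fun e f => do
    let y ← rd f (e.2, e.1)
    let back ← less 0 y
    if back then do
      let z ← sub y γ
      wr f (e.2, e.1) z
    else do
      let x ← rd f e
      let z ← add x γ
      wr f e z

/-- One iteration of the loop, for the chosen vertices `vp` and `vm`, with the next evaluation of
the loop condition. -/
def iteration [Fintype V] [DecidableEq V] (vs : List V) (A : V × V → Bool) (S : FlowState V)
    (vp vm : V) : TimeM (FlowState V) := do
  tick -- the choice of `vp`
  tick -- the choice of `vm`
  let w ← residualLengths vs A S.f S.pot
  let r ← dijkstra vs w vp vm
  let pot ← updatePotential vs S.pot r.1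
  let x ← rd S.exc vp
  let y ← rd S.exc vm
  let y' ← sub 0 y
  let γ₀ ← minimum x y'
  let γ ← bottleneck r.2 S.f γ₀
  let f ← augment r.2 γ S.f
  let x' ← sub x γ
  let exc₁ ← wr S.exc vp x'
  let y'' ← add y γ
  let exc₂ ← wr exc₁ vm y''
  let l ← signLists vs exc₂
  tick -- the loop condition
  pure ⟨f, pot, exc₂, l.1, l.2⟩

/-- An iteration leads from `S` to `S'` in `c` steps, for some choice of a vertex with positive
and a vertex with negative remaining supply. -/
def Step [Fintype V] [DecidableEq V] (vs : List V) (A : V × V → Bool) (S S' : FlowState V)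
    (c : ℕ) : Prop :=
  ∃ vp ∈ S.excPos, ∃ vm ∈ S.excNeg,
    S' = (iteration vs A S vp vm).val ∧ c = (iteration vs A S vp vm).time

/-- `Run vs A d S k t`: the algorithm can be in state `S` after `k` iterations and, in
total, `t` steps. -/
inductive Run [Fintype V] [DecidableEq V] (vs : List V) (A : V × V → Bool) (d : V × V → ℤ) :
    FlowState V → ℕ → ℕ → Prop
  | init : Run vs A d (initialStep vs A d).val 0 (initialStep vs A d).time
  | step {S S' : FlowState V} {k t c : ℕ} :
      Run vs A d S k t → Step vs A S S' c → Run vs A d S' (k + 1) (t + c)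

end Algorithm

/-! ## The graph -/

/-- The vertex set `{-N-2, …, 0}^s`. -/
abbrev Vertex (s N : ℕ) : Type := Fin s → Finset.Icc (-(N : ℤ) - 2) 0

/-- The directed graph with the edges `(β, β - ε_ℓ)` for `β ∈ {-N-1, …, 0}^s` and `ℓ = 1, …, s`,
where `ε_ℓ` is the standard unit vector. -/
def gridGraph (s N : ℕ) : Digraph (Vertex s N) where
  Adj u v := (∀ i, -(N : ℤ) - 1 ≤ (u i : ℤ)) ∧
    ∃ ℓ : Fin s, ∀ i, (v i : ℤ) = (u i : ℤ) - if i = ℓ then 1 else 0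

instance (s N : ℕ) : DecidableRel (gridGraph s N).Adj := fun u v =>
  inferInstanceAs (Decidable ((∀ i, -(N : ℤ) - 1 ≤ (u i : ℤ)) ∧
    ∃ ℓ : Fin s, ∀ i, (v i : ℤ) = (u i : ℤ) - if i = ℓ then 1 else 0))

end SubdivisionFlow

/-!
# Correctness and running time of Dijkstra's algorithm and of successive shortest paths

*Running times.* The cost of the body of every loop has a bound that does not depend on the data, so
that `time_forEach_le` bounds each loop by the number of its passes. Loops are nested at most twice
and the lists they run through have at most `n` elements; hence Dijkstra's algorithm, and with it
every iteration of the flow algorithm, takes `O(n ^ 2)` steps.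

*Dijkstra's algorithm.* When an unsettled vertex of least tentative distance is settled, nonnegative
lengths guarantee that the relaxation of its arcs changes no settled vertex
(`DijkstraInvariant.settle`). In the end the array `δ` satisfies `δ s = 0` and
`δ v ≤ δ u + w (u, v)`, which makes it a lower bound for all walks (`le_add_sum_of_isWalk`), and the
predecessors yield walks that attain it (`tracePath_spec`). The round in which a vertex is settled
serves as a rank that increases from predecessor to successor. It bounds the length of the path and
keeps the path simple in the presence of cycles of length `0`, which the residual networks have.

*The flow algorithm.* The algorithm maintains a nonnegative flow and potentials such that all
residual arcs have nonnegative reduced costs (`FlowInvariant`). Subtracting the distances from the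
potentials preserves this and turns the reduced costs on the path into `0`
(`FlowInvariant.pot_sub_dist`), so that the reverses of the arcs of the path, which the augmentation
may add to the residual network, do no harm (`FlowInvariant.iteration`). Since the supplies are
integers, every iteration decreases `∑ v, |exc v|` by at least `2`, which bounds the number of
iterations by `B` (`Run.invariant`). When no supply remains, nonnegative reduced costs say that the
potentials are dual feasible and that the dual constraints are tight where the flow is positive;
hence both solutions are optimal by complementary slackness (`isOptimal_of_complementary`).

A path from `vp` to `vm` always exists: a vertex with supply has a neighbour, and in the grid graph
all vertices that have a neighbour are connected with `0` (`gridGraph_connected`).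
-/

namespace SubdivisionFlow

/-! ### Costs and invariants of loops -/

section Loops

@[simp] theorem val_pure {α : Type} (a : α) : (pure a : TimeM α).val = a := rfl

@[simp] theorem time_pure {α : Type} (a : α) : (pure a : TimeM α).time = 0 := rfl

@[simp] theorem val_bind {α β : Type} (m : TimeM α) (k : α → TimeM β) :
    (m >>= k).val = (k m.val).val := rfl

@[simp] theorem time_bind {α β : Type} (m : TimeM α) (k : α → TimeM β) :
    (m >>= k).time = m.time + (k m.val).time := rfl

variable {ι σ : Type}

/-- An invariant of a loop that visits every index exactly once; `S` is the set of the indices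
that have been visited. -/
theorem forEach_induction [Fintype ι] [DecidableEq ι] {l : List ι} (hl : l.Nodup)
    (hmem : ∀ i, i ∈ l) {body : ι → σ → TimeM σ} (P : Finset ι → σ → Prop) {s : σ}
    (h0 : P ∅ s) (hstep : ∀ i S s, i ∉ S → P S s → P (insert i S) (body i s).val) :
    P Finset.univ (forEach l s body).val := by
  have key : ∀ (l : List ι) (S : Finset ι) (s : σ), l.Nodup → (∀ i ∈ l, i ∉ S) → P S s →
      P (S ∪ l.toFinset) (forEach l s body).val := by
    intro l
    induction l with
    | nil => intro S s _ _ h; simpa [forEach] using h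
    | cons i l ih =>
      intro S s hl hS h
      have hi := List.nodup_cons.1 hl
      have := ih (insert i S) (body i s).val hi.2 (by
        intro j hj hjS
        rcases Finset.mem_insert.1 hjS with rfl | hjS
        · exact hi.1 hj
        · exact hS j (List.mem_cons_of_mem _ hj) hjS) (hstep i S s (hS i List.mem_cons_self) h)
      simpa [forEach] using this
  have := key l ∅ s hl (by simp) h0
  have hu : l.toFinset = Finset.univ := Finset.eq_univ_iff_forall.2 (by simpa using hmem)
  rwa [Finset.empty_union, hu] at this

/-- Derives a property `Q` of the result of a loop from an invariant `P`, without mention of the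
body of the loop. -/
theorem forEach_induction_on [Fintype ι] [DecidableEq ι] {l : List ι} (hl : l.Nodup)
    (hmem : ∀ i, i ∈ l) {body : ι → σ → TimeM σ} (P : Finset ι → σ → Prop) {Q : σ → Prop} {s : σ}
    (hQ : ∀ r, P Finset.univ r → Q r) (h0 : P ∅ s)
    (hstep : ∀ i S s, i ∉ S → P S s → P (insert i S) (body i s).val) :
    Q (forEach l s body).val :=
  hQ _ (forEach_induction hl hmem P h0 hstep)

theorem time_forEach_le {body : ι → σ → TimeM σ} {c : ℕ} (h : ∀ i s, (body i s).time ≤ c)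
    (l : List ι) (s : σ) : (forEach l s body).time ≤ l.length * (c + 1) := by
  induction l generalizing s with
  | nil => simp [forEach]
  | cons i l ih =>
    have h1 := h i s
    have h2 := ih (body i s).val
    simp only [forEach, time_bind, tick, List.length_cons, Nat.add_mul]
    omega

theorem length_eq_card [Fintype ι] {l : List ι} (hl : l.Nodup) (hmem : ∀ i, i ∈ l) :
    l.length = Fintype.card ι := by
  classical
  have hu : l.toFinset = Finset.univ := Finset.eq_univ_iff_forall.2 (by simpa using hmem)
  rw [← List.toFinset_card_of_nodup hl, hu, Finset.card_univ]

end Loops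

/-! ### Dijkstra's algorithm -/

section Dijkstra

variable {V R : Type}

theorem le_add_sum_of_isWalk [AddCommMonoid R] [PartialOrder R] [IsOrderedAddMonoid R]
    {w : V × V → WithTop R} {δ : V → WithTop R} (hδ : ∀ u v, δ v ≤ δ u + w (u, v)) {s t : V}
    {P : List (V × V)} (hP : IsWalk s t P) :
    δ t ≤ δ s + (P.map w).sum := by
  induction hP with
  | nil v => simp
  | cons _ ih =>
    rw [List.map_cons, List.sum_cons, ← add_assoc]
    exact ih.trans (add_le_add_left (hδ _ _) _)

/-- If a rank increases along the arcs of a walk, then no arc of it occurs again, in either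
direction. -/
theorem IsWalk.pairwise_of_rank {rank : V → ℕ} {s t : V} {P : List (V × V)} (hP : IsWalk s t P)
    (hr : ∀ e ∈ P, rank e.1 < rank e.2) : P.Pairwise fun e e' => e' ≠ e ∧ e' ≠ e.swap := by
  suffices (∀ e ∈ P, rank s ≤ rank e.1) ∧ P.Pairwise fun e e' => e' ≠ e ∧ e' ≠ e.swap from
    this.2
  induction hP with
  | nil v => simp
  | @cons u v t P _ ih =>
    obtain ⟨h1, h2⟩ := ih fun e he => hr e (List.mem_cons_of_mem _ he)
    have huv : rank u < rank v := hr _ List.mem_cons_self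
    refine ⟨?_, List.pairwise_cons.2 ⟨fun e he => ?_, h2⟩⟩
    · simp only [List.mem_cons]
      rintro e (rfl | he)
      · exact le_rfl
      · exact huv.le.trans (h1 e he)
    · have h3 := h1 e he
      have h4 := hr e (List.mem_cons_of_mem _ he)
      constructor
      · rintro rfl
        simp only at h3
        omega
      · rintro rfl
        simp only [Prod.swap_prod_mk] at h4
        omega

theorem time_selectMin_le [LinearOrder R] (vs : List V) (D : DijkstraState V R) :
    (selectMin vs D).time ≤ vs.length * 5 := by
  refine time_forEach_le (fun v best => ?_) _ _
  simp only [time_bind, rd]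
  split
  · simp
  · split
    · simp
    · simp only [time_bind, less]
      split <;> simp

theorem selectMin_eq_none [Fintype V] [DecidableEq V] [LinearOrder R] {vs : List V}
    (hvs : vs.Nodup) (hmem : ∀ v, v ∈ vs) {D : DijkstraState V R}
    (h : (selectMin vs D).val = none) (v : V) : D.settled v = true := by
  refine forEach_induction hvs hmem
    (fun S (best : Option V) => best = none → ∀ v ∈ S, D.settled v = true) (by simp) ?_ h v
    (Finset.mem_univ v)
  intro v S best _ ih
  simp only [val_bind, rd]
  split
  · intro hb x hx
    rcases Finset.mem_insert.1 hx with rfl | hx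
    · assumption
    · exact ih hb x hx
  · split
    · simp
    · simp only [val_bind, less]
      split <;> simp

theorem selectMin_eq_some [Fintype V] [DecidableEq V] [LinearOrder R] {vs : List V}
    (hvs : vs.Nodup) (hmem : ∀ v, v ∈ vs) {D : DijkstraState V R} {u : V}
    (h : (selectMin vs D).val = some u) :
    D.settled u = false ∧ ∀ v, D.settled v = false → D.dist u ≤ D.dist v := by
  let Inv : Finset V → Option V → Prop := fun S best =>
    (best = none → ∀ v ∈ S, D.settled v = true) ∧
      ∀ u, best = some u → D.settled u = false ∧ ∀ v ∈ S, D.settled v = false →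
        D.dist u ≤ D.dist v
  suffices key : Inv Finset.univ (selectMin vs D).val from
    ⟨(key.2 u h).1, fun v => (key.2 u h).2 v (Finset.mem_univ v)⟩
  refine forEach_induction hvs hmem Inv (by simp [Inv]) ?_
  intro v S best _ ⟨ih1, ih2⟩
  simp only [val_bind, rd]
  split
  · simp only [Inv, val_pure, Finset.mem_insert]
    grind
  · split
    · simp only [Inv, val_pure, Finset.mem_insert]
      grind
    · simp only [val_bind, less]
      split <;> simp only [Inv, val_pure, Finset.mem_insert] <;> grind

variable [DecidableEq V] [AddCommMonoid R] [LinearOrder R]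

theorem time_relax_le (vs : List V) (w : V × V → WithTop R) (u : V) (D : DijkstraState V R) :
    (relax vs w u D).time ≤ vs.length * 8 := by
  refine time_forEach_le (fun v D => ?_) _ _
  simp only [time_bind, rd, add, less]
  split <;> simp [wr]

theorem settled_relax (vs : List V) (w : V × V → WithTop R) (u : V) (D : DijkstraState V R) :
    (relax vs w u D).val.settled = D.settled := by
  unfold relax
  induction vs generalizing D with
  | nil => rfl
  | cons v vs ih =>
    simp only [forEach, val_bind]
    rw [ih]
    simp only [rd, add, less]
    by_cases h : D.dist u + w (u, v) < D.dist v <;> simp [h, wr]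

/-- The arc lengths are nonnegative, so that the tentative distance of `u` is not changed by the
loop. -/
theorem relax_apply [Fintype V] [IsOrderedAddMonoid R] {vs : List V} (hvs : vs.Nodup)
    (hmem : ∀ v, v ∈ vs) {w : V × V → WithTop R} (hw : ∀ e, 0 ≤ w e) (u : V)
    (D : DijkstraState V R) (v : V) :
    (relax vs w u D).val.dist v = min (D.dist v) (D.dist u + w (u, v)) ∧
      (relax vs w u D).val.pred v =
        if D.dist u + w (u, v) < D.dist v then some u else D.pred v := by
  have hu : ∀ e, D.dist u ≤ D.dist u + w e := fun e => le_add_of_nonneg_right (hw e)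
  let Inv : Finset V → DijkstraState V R → Prop := fun S D' =>
    (∀ v ∈ S, D'.dist v = min (D.dist v) (D.dist u + w (u, v)) ∧
      D'.pred v = if D.dist u + w (u, v) < D.dist v then some u else D.pred v) ∧
    ∀ v ∉ S, D'.dist v = D.dist v ∧ D'.pred v = D.pred v
  suffices key : Inv Finset.univ (relax vs w u D).val from key.1 v (Finset.mem_univ v)
  refine forEach_induction hvs hmem Inv (by simp [Inv]) ?_
  intro v S D' hv ⟨h1, h2⟩
  have hdu : D'.dist u = D.dist u := by
    by_cases huS : u ∈ S
    · rw [(h1 u huS).1, min_eq_left (hu _)]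
    · exact (h2 u huS).1
  simp only [val_bind, rd, add, less, hdu, (h2 v hv).1, decide_eq_true_eq]
  split
  · rename_i hlt
    simp only [Inv, val_bind, wr, val_pure, Finset.mem_insert]
    refine ⟨fun x hx => ?_, fun x hx => ?_⟩
    · by_cases hxv : x = v
      · subst hxv
        simp [hlt, hlt.le]
      · simpa [hxv] using h1 x (hx.resolve_left hxv)
    · rw [not_or] at hx
      simpa [hx.1] using h2 x hx.2
  · rename_i hlt
    simp only [Inv, val_pure, Finset.mem_insert]
    refine ⟨fun x hx => ?_, fun x hx => h2 x (fun h => hx (Or.inr h))⟩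
    by_cases hxv : x = v
    · subst hxv
      rw [(h2 x hv).1, (h2 x hv).2, if_neg hlt, min_eq_left (not_lt.1 hlt)]
      exact ⟨rfl, rfl⟩
    · exact h1 x (hx.resolve_left hxv)

/-- The invariant of Dijkstra's algorithm after `k` vertices have been settled. The number
`rank v` is the round in which `v` has been settled, and `k` if `v` has not been settled yet. The
rank increases along the arcs from a predecessor to its successor, which makes the path found at
the end simple, even if there are cycles of length `0`. -/
structure DijkstraInvariant [Fintype V] (w : V × V → WithTop R) (s : V) (k : ℕ) (rank : V → ℕ)
    (D : DijkstraState V R) : Prop where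
  card_settled : (Finset.univ.filter fun v => D.settled v = true).card = k
  dist_source : D.dist s = 0
  dist_nonneg : ∀ v, 0 ≤ D.dist v
  dist_le_of_settled : ∀ u v, D.settled u = true → D.settled v = false → D.dist u ≤ D.dist v
  dist_le_add : ∀ u v, D.settled u = true → D.dist v ≤ D.dist u + w (u, v)
  pred_eq_none : ∀ v, v ≠ s → D.pred v = none → D.dist v = ⊤
  pred_eq_some : ∀ v u, D.pred v = some u →
    D.settled u = true ∧ D.dist v = D.dist u + w (u, v) ∧ rank u < rank v
  rank_lt : ∀ v, D.settled v = true → rank v < k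
  rank_eq : ∀ v, D.settled v = false → rank v = k

/-- An unsettled vertex `u` of least tentative distance can be settled: by nonnegativity of the arc
lengths, no relaxation of an arc from `u` improves a settled vertex. -/
theorem DijkstraInvariant.settle [Fintype V] [IsOrderedAddMonoid R] {vs : List V}
    (hvs : vs.Nodup) (hmem : ∀ v, v ∈ vs) {w : V × V → WithTop R} (hw : ∀ e, 0 ≤ w e) {s u : V}
    {k : ℕ} {rank : V → ℕ} {D : DijkstraState V R} (h : DijkstraInvariant w s k rank D)
    (hu : D.settled u = false) (hmin : ∀ v, D.settled v = false → D.dist u ≤ D.dist v) :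
    DijkstraInvariant w s (k + 1)
      (fun v => if D.settled v = true then rank v else if v = u then k else k + 1)
      (relax vs w u { D with settled := Function.update D.settled u true }).val := by
  set D₁ : DijkstraState V R := { D with settled := Function.update D.settled u true } with hD₁
  have hset : ∀ v, (relax vs w u D₁).val.settled v = true ↔ v = u ∨ D.settled v = true := by
    intro v
    rw [settled_relax]
    by_cases hv : v = u <;> simp [hD₁, hv]
  have hset' : ∀ v, (relax vs w u D₁).val.settled v = false ↔ v ≠ u ∧ D.settled v = false := by
    intro v
    rw [← Bool.not_eq_true, hset, not_or, Bool.not_eq_true]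
  have hdist : ∀ v, (relax vs w u D₁).val.dist v = min (D.dist v) (D.dist u + w (u, v)) :=
    fun v => (relax_apply hvs hmem hw u D₁ v).1
  have hpred : ∀ v, (relax vs w u D₁).val.pred v =
      if D.dist u + w (u, v) < D.dist v then some u else D.pred v :=
    fun v => (relax_apply hvs hmem hw u D₁ v).2
  have hle : ∀ v, v = u ∨ D.settled v = true → D.dist v ≤ D.dist u := by
    rintro v (rfl | hv)
    · exact le_rfl
    · exact h.dist_le_of_settled v u hv hu
  have hadd : ∀ e, D.dist u ≤ D.dist u + w e := fun e => le_add_of_nonneg_right (hw e)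
  -- settled vertices are not affected by the relaxation
  have hfix : ∀ v, v = u ∨ D.settled v = true → (relax vs w u D₁).val.dist v = D.dist v :=
    fun v hv => by rw [hdist, min_eq_left ((hle v hv).trans (hadd _))]
  refine ⟨?_, ?_, ?_, ?_, ?_, ?_, ?_, ?_, ?_⟩
  · rw [← h.card_settled]
    have : (Finset.univ.filter fun v => (relax vs w u D₁).val.settled v = true) =
        insert u (Finset.univ.filter fun v => D.settled v = true) := by
      ext v
      simp [hset]
    rw [this, Finset.card_insert_of_notMem (by simp [hu])]
  · rw [hdist, h.dist_source, min_eq_left (add_nonneg (h.dist_nonneg u) (hw _))]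
  · intro v
    rw [hdist]
    exact le_min (h.dist_nonneg v) (add_nonneg (h.dist_nonneg u) (hw _))
  · intro x y hx hy
    rw [hset] at hx
    rw [hset'] at hy
    rw [hfix x hx, hdist]
    exact le_min ((hle x hx).trans (hmin y hy.2)) ((hle x hx).trans (hadd _))
  · intro x y hx
    rw [hset] at hx
    rw [hfix x hx, hdist]
    rcases hx with rfl | hx
    · exact min_le_right _ _
    · exact (min_le_left _ _).trans (h.dist_le_add x y hx)
  · intro v hv hn
    rw [hpred] at hn
    split at hn
    · cases hn
    · rename_i hlt
      rw [hdist, min_eq_left (not_lt.1 hlt)]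
      exact h.pred_eq_none v hv hn
  · intro v x hx
    rw [hpred] at hx
    split at hx
    · rename_i hlt
      obtain rfl : u = x := Option.some.inj hx
      have hv : ¬ (v = u ∨ D.settled v = true) :=
        fun hv => absurd hlt (not_lt.2 ((hle v hv).trans (hadd _)))
      rw [not_or] at hv
      rw [hfix u (Or.inl rfl), hdist, min_eq_right hlt.le, hset]
      refine ⟨Or.inl rfl, rfl, ?_⟩
      simp [hu, hv.1, hv.2]
    · rename_i hlt
      obtain ⟨h1, h2, h3⟩ := h.pred_eq_some v x hx
      rw [hfix x (Or.inr h1), hdist, min_eq_left (not_lt.1 hlt), hset]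
      refine ⟨Or.inr h1, h2, ?_⟩
      have := h.rank_lt x h1
      simp only [h1, if_true]
      split_ifs <;> omega
  · intro v hv
    rw [hset] at hv
    by_cases hvs : D.settled v = true
    · have := h.rank_lt v hvs
      simp only [hvs, if_true]
      omega
    · simp [hv.resolve_right hvs, hu]
  · intro v hv
    rw [hset'] at hv
    simp [hv.1, hv.2]

theorem time_tracePath_le (vs : List V) (pred : V → Option V) (s t : V) :
    (tracePath vs pred s t).time ≤ vs.length * 4 := by
  simp only [tracePath, time_bind, time_pure, add_zero]
  refine time_forEach_le (fun v r => ?_) _ _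
  simp only [time_bind, equal]
  split
  · simp
  · simp only [time_bind, rd]
    split <;> simp [push]

theorem length_tracePath_le (vs : List V) (pred : V → Option V) (s t : V) :
    (tracePath vs pred s t).val.length ≤ vs.length := by
  simp only [tracePath, val_bind, val_pure]
  have key : ∀ (vs : List V) (r : V × List (V × V)),
      (forEach vs r fun _ r => do
        let b ← equal r.1 s
        if b then pure r
        else do
          let p ← rd pred r.1
          match p with
          | none => pure r
          | some u => do
              let P ← push (u, r.1) r.2
              pure (u, P)).val.2.length ≤ vs.length + r.2.length := by
    intro vs
    induction vs with
    | nil => intro r; simp [forEach]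
    | cons v vs ih =>
      intro r
      simp only [forEach, val_bind]
      refine (ih _).trans ?_
      by_cases h : r.1 = s
      · simp [equal, h]
      · cases hp : pred r.1 with
        | none => simp [equal, rd, h, hp]
        | some u =>
          simp only [equal, h, rd, hp, decide_false, Bool.false_eq_true, if_false, val_bind, push,
            val_pure, List.length_cons]
          omega
  exact key vs (t, [])

/-- With the distances `δ`, the arc `e` is the last one of a shortest path of finite length. -/
def IsTight (w : V × V → WithTop R) (δ : V → WithTop R) (e : V × V) : Prop :=
  δ e.2 ≠ ⊤ ∧ δ e.2 = δ e.1 + w e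

/-- The rank drops in every pass until `s` is reached, and it is less than the number of vertices at
the start. Therefore `n` passes suffice. -/
theorem tracePath_spec [Fintype V] {vs : List V} (hvs : vs.Nodup) (hmem : ∀ v, v ∈ vs)
    {w : V × V → WithTop R} {s : V} {rank : V → ℕ} {D : DijkstraState V R}
    (h : DijkstraInvariant w s (Fintype.card V) rank D) {t : V} (ht : D.dist t ≠ ⊤) :
    IsWalk s t (tracePath vs D.pred s t).val ∧
      ((tracePath vs D.pred s t).val.map w).sum = D.dist t ∧
      ∀ e ∈ (tracePath vs D.pred s t).val, IsTight w D.dist e ∧ rank e.1 < rank e.2 := by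
  have hset : ∀ v, D.settled v = true := by
    have h1 := Finset.eq_univ_of_card _ h.card_settled
    intro v
    simpa using Finset.ext_iff.1 h1 v
  simp only [tracePath, val_bind, val_pure]
  refine forEach_induction_on hvs hmem (fun S (r : V × List (V × V)) =>
    IsWalk r.1 t r.2 ∧ D.dist r.1 + (r.2.map w).sum = D.dist t ∧
      (∀ e ∈ r.2, IsTight w D.dist e ∧ rank e.1 < rank e.2) ∧
      (r.1 = s ∨ rank r.1 + S.card ≤ rank t))
    (Q := fun r => IsWalk s t r.2 ∧ (r.2.map w).sum = D.dist t ∧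
      ∀ e ∈ r.2, IsTight w D.dist e ∧ rank e.1 < rank e.2) ?_ ⟨.nil t, by simp, by simp, by simp⟩ ?_
  · rintro ⟨x, P⟩ ⟨h1, h2, h3, h4⟩
    have hr := h.rank_lt t (hset t)
    rw [Finset.card_univ] at h4
    obtain rfl : x = s := h4.resolve_right (by omega)
    rw [h.dist_source, zero_add] at h2
    exact ⟨h1, h2, h3⟩
  rintro v S ⟨x, P⟩ hv ⟨h1, h2, h3, h4⟩
  simp only at h1 h2 h3 h4
  simp only [val_bind, equal, decide_eq_true_eq]
  split
  · rename_i hx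
    exact ⟨h1, h2, h3, Or.inl hx⟩
  · rename_i hx
    have hfin : D.dist x ≠ ⊤ := by
      intro hx'
      rw [hx', WithTop.top_add] at h2
      exact ht h2.symm
    cases hp : D.pred x with
    | none => exact absurd (h.pred_eq_none x hx hp) hfin
    | some u =>
      obtain ⟨-, g2, g3⟩ := h.pred_eq_some x u hp
      simp only [val_bind, rd, hp, push, val_pure]
      refine ⟨.cons h1, ?_, ?_, Or.inr ?_⟩
      · rw [List.map_cons, List.sum_cons, ← add_assoc, ← g2, h2]
      · simp only [List.mem_cons]
        rintro e (rfl | he)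
        · exact ⟨⟨hfin, g2⟩, g3⟩
        · exact h3 e he
      · rw [Finset.card_insert_of_notMem hv]
        have := h4.resolve_left hx
        omega

/-- Each of the `n` rounds settles a vertex, including the ones that cannot be reached from `s`. -/
theorem dijkstra_invariant [Fintype V] [IsOrderedAddMonoid R] {vs : List V}
    (hvs : vs.Nodup) (hmem : ∀ v, v ∈ vs) {w : V × V → WithTop R} (hw : ∀ e, 0 ≤ w e) (s t : V) :
    ∃ rank D, DijkstraInvariant w s (Fintype.card V) rank D ∧
      (dijkstra vs w s t).val = (D.dist, (tracePath vs D.pred s t).val) := by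
  simp only [dijkstra, val_bind, val_pure, newArray, wr]
  refine forEach_induction_on hvs hmem
    (fun S (D : DijkstraState V R) => ∃ rank, DijkstraInvariant w s S.card rank D)
    (Q := fun D' => ∃ rank D, DijkstraInvariant w s (Fintype.card V) rank D ∧
      (D'.dist, (tracePath vs D'.pred s t).val) = (D.dist, (tracePath vs D.pred s t).val)) ?_ ?_ ?_
  · rintro D ⟨rank, h⟩
    exact ⟨rank, D, h, rfl⟩
  · refine ⟨fun _ => 0, by simp, by simp, fun v => ?_, by simp, by simp, ?_, by simp, by simp,
      by simp⟩
    · by_cases hv : v = s <;> simp [hv]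
    · intro v hv _
      simp [hv]
  · rintro v S D hv ⟨rank, h⟩
    rw [Finset.card_insert_of_notMem hv]
    simp only [val_bind]
    split
    · rename_i hn
      exfalso
      have h1 := h.card_settled
      rw [Finset.filter_true_of_mem fun v _ => selectMin_eq_none hvs hmem hn v] at h1
      exact hv (Finset.eq_univ_of_card S (h1.symm.trans Finset.card_univ) ▸ Finset.mem_univ v)
    · rename_i u hu
      obtain ⟨h1, h2⟩ := selectMin_eq_some hvs hmem hu
      exact ⟨_, h.settle hvs hmem hw h1 h2⟩

/-- The flow algorithm needs more than a shortest path: the arcs of the path must be tight, and none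
of them may occur again, in either direction, which a zero-length cycle could cause. -/
theorem dijkstra_spec [Fintype V] [IsOrderedAddMonoid R] {vs : List V} (hvs : vs.Nodup)
    (hmem : ∀ v, v ∈ vs) {w : V × V → WithTop R} (hw : ∀ e, 0 ≤ w e) (s t : V) :
    (dijkstra vs w s t).val.1 s = 0 ∧
      (∀ u v, (dijkstra vs w s t).val.1 v ≤ (dijkstra vs w s t).val.1 u + w (u, v)) ∧
      ((dijkstra vs w s t).val.1 t ≠ ⊤ →
        IsWalk s t (dijkstra vs w s t).val.2 ∧
        (∀ e ∈ (dijkstra vs w s t).val.2, IsTight w (dijkstra vs w s t).val.1 e) ∧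
        (dijkstra vs w s t).val.2.Pairwise fun e e' => e' ≠ e ∧ e' ≠ e.swap) := by
  obtain ⟨rank, D, h, hD⟩ := dijkstra_invariant hvs hmem hw s t
  have h1 := Finset.eq_univ_of_card _ h.card_settled
  rw [hD]
  refine ⟨h.dist_source, fun u v => h.dist_le_add u v (by simpa using Finset.ext_iff.1 h1 u),
    fun ht => ?_⟩
  obtain ⟨g1, -, g3⟩ := tracePath_spec hvs hmem h ht
  exact ⟨g1, fun e he => (g3 e he).1, g1.pairwise_of_rank fun e he => (g3 e he).2⟩

theorem dijkstra_path [Fintype V] [IsOrderedAddMonoid R] {vs : List V} (hvs : vs.Nodup)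
    (hmem : ∀ v, v ∈ vs) {w : V × V → WithTop R} (hw : ∀ e, 0 ≤ w e) {s t : V}
    (ht : (dijkstra vs w s t).val.1 t ≠ ⊤) :
    IsWalk s t (dijkstra vs w s t).val.2 ∧
      ((dijkstra vs w s t).val.2.map w).sum = (dijkstra vs w s t).val.1 t := by
  obtain ⟨rank, D, h, hD⟩ := dijkstra_invariant hvs hmem hw s t
  rw [hD] at ht ⊢
  obtain ⟨g1, g2, -⟩ := tracePath_spec hvs hmem h ht
  exact ⟨g1, g2⟩

theorem dijkstra_isDistance [Fintype V] [IsOrderedAddMonoid R] {vs : List V} (hvs : vs.Nodup)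
    (hmem : ∀ v, v ∈ vs) {w : V × V → WithTop R} (hw : ∀ e, 0 ≤ w e) (s t v : V) :
    IsDistance w s v ((dijkstra vs w s t).val.1 v) := by
  obtain ⟨h1, h2, -⟩ := dijkstra_spec hvs hmem hw s t
  refine ⟨?_, ?_⟩
  · by_cases hv : (dijkstra vs w s t).val.1 v = ⊤
    · -- every walk is infinitely long then, for instance the one along the missing arc `(s, v)`
      refine ⟨[(s, v)], .cons (.nil v), ?_⟩
      have := h2 s v
      rw [hv, h1, zero_add] at this
      simpa [hv] using top_le_iff.1 this
    · -- the distances do not depend on the target, so that the path to `v` can be traced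
      have hd : (dijkstra vs w s v).val.1 = (dijkstra vs w s t).val.1 := rfl
      rw [← hd] at hv ⊢
      exact ⟨_, dijkstra_path hvs hmem hw hv⟩
  · rintro _ ⟨P, hP, rfl⟩
    have := le_add_sum_of_isWalk h2 hP
    rwa [h1, zero_add] at this

theorem length_dijkstra_path_le [Fintype V] (vs : List V) (w : V × V → WithTop R) (s t : V) :
    (dijkstra vs w s t).val.2.length ≤ vs.length :=
  length_tracePath_le _ _ _ _

theorem time_dijkstra_le [Fintype V] {vs : List V} (hvs : vs.Nodup) (hmem : ∀ v, v ∈ vs)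
    (w : V × V → WithTop R) (s t : V) :
    (dijkstra vs w s t).time ≤ 23 * Fintype.card V ^ 2 := by
  have hn := length_eq_card hvs hmem
  have hpos : 0 < Fintype.card V := Fintype.card_pos_iff.2 ⟨s⟩
  simp only [dijkstra, time_bind, time_pure, newArray, wr]
  refine (Nat.add_le_add_left (Nat.add_le_add_left (Nat.add_le_add_left (Nat.add_le_add_left
    (Nat.add_le_add (time_forEach_le (c := vs.length * 5 + (1 + vs.length * 8)) ?_ _ _)
      (Nat.add_le_add_right (time_tracePath_le _ _ _ _) 0)) _) _) _) _).trans ?_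
  · intro _ D
    simp only [time_bind]
    refine Nat.add_le_add (time_selectMin_le _ _) ?_
    split
    · simp
    · exact Nat.add_le_add_left (time_relax_le _ _ _ _) 1
  · rw [hn]
    nlinarith

end Dijkstra

/-! ### The parts of the flow algorithm -/

section Parts

variable {V : Type}

theorem time_computeSupply_le [Fintype V] [DecidableEq V] (vs : List V) (A : V × V → Bool)
    (d : V × V → ℤ) :
    (computeSupply vs A d).time ≤ Fintype.card V + vs.length * (vs.length * 11 + 1) := by
  simp only [computeSupply, time_bind, newArray]
  refine Nat.add_le_add_left
    (time_forEach_le (fun v b => time_forEach_le (fun u b => ?_) _ _) _ _) _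
  by_cases h1 : A (v, u) = true <;> by_cases h2 : A (u, v) = true <;>
    simp [rd, add, sub, wr, h1, h2]

theorem time_signLists_le (vs : List V) (exc : V → ℤ) :
    (signLists vs exc).time ≤ vs.length * 5 := by
  refine time_forEach_le (fun v r => ?_) _ _
  simp only [time_bind, rd, less]
  split
  · simp [push]
  · split <;> simp [push]

theorem time_residualLengths_le [Fintype V] [DecidableEq V] (vs : List V) (A : V × V → Bool)
    (f : V × V → ℤ) (pot : V → ℤ) : (residualLengths vs A f pot).time ≤
      Fintype.card V ^ 2 + vs.length * (vs.length * 13 + 1) := by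
  simp only [residualLengths, time_bind, newArray, Fintype.card_prod, ← sq]
  refine Nat.add_le_add_left
    (time_forEach_le (fun v b => time_forEach_le (fun u b => ?_) _ _) _ _) _
  cases h1 : A (v, u) <;> cases h2 : A (u, v) <;> by_cases h3 : 0 < f (u, v) <;>
    simp [rd, less, add, sub, wr, h1, h2, h3]

theorem time_updatePotential_le [DecidableEq V] (vs : List V) (pot : V → ℤ)
    (δ : V → WithTop ℤ) : (updatePotential vs pot δ).time ≤ vs.length * 5 := by
  refine time_forEach_le (fun v r => ?_) _ _
  simp only [time_bind, rd]
  split <;> simp [sub, wr]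

theorem time_bottleneck_le (P : List (V × V)) (f : V × V → ℤ) (γ₀ : ℤ) :
    (bottleneck P f γ₀).time ≤ P.length * 4 := by
  refine time_forEach_le (fun v r => ?_) _ _
  simp only [time_bind, rd, less]
  split <;> simp [minimum]

theorem time_augment_le [DecidableEq V] (P : List (V × V)) (γ : ℤ) (f : V × V → ℤ) :
    (augment P γ f).time ≤ P.length * 6 := by
  refine time_forEach_le (fun v r => ?_) _ _
  simp only [time_bind, rd, less]
  split <;> simp [sub, wr, add]

theorem time_initialStep_le [Fintype V] [DecidableEq V] [Nonempty V] {vs : List V}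
    (hvs : vs.Nodup) (hmem : ∀ v, v ∈ vs) (A : V × V → Bool) (d : V × V → ℤ) :
    (initialStep vs A d).time ≤ 69 * Fintype.card V ^ 2 := by
  have hn := length_eq_card hvs hmem
  have hpos : 0 < Fintype.card V := Fintype.card_pos
  have h1 := time_computeSupply_le vs A d
  have h2 := time_signLists_le vs (computeSupply vs A d).val
  simp only [initialStep, time_bind, newArray, tick, time_pure, Fintype.card_prod]
  rw [hn] at h1 h2
  nlinarith

theorem time_iteration_le [Fintype V] [DecidableEq V] {vs : List V} (hvs : vs.Nodup)
    (hmem : ∀ v, v ∈ vs) (A : V × V → Bool) (S : FlowState V) (vp vm : V) :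
    (iteration vs A S vp vm).time ≤ 69 * Fintype.card V ^ 2 := by
  have hn := length_eq_card hvs hmem
  have hpos : 0 < Fintype.card V := Fintype.card_pos_iff.2 ⟨vp⟩
  have h1 := time_residualLengths_le vs A S.f S.pot
  simp only [iteration, time_bind, rd, sub, add, minimum, wr, tick, time_pure]
  generalize (residualLengths vs A S.f S.pot).val = w
  have h2 := time_dijkstra_le hvs hmem w vp vm
  have h3 := length_dijkstra_path_le vs w vp vm
  generalize (dijkstra vs w vp vm).val = r at h3 ⊢
  have h4 := time_updatePotential_le vs S.pot r.1
  have h5 := time_bottleneck_le r.2 S.f (min (S.exc vp) (0 - S.exc vm))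
  generalize (bottleneck r.2 S.f (min (S.exc vp) (0 - S.exc vm))).val = γ
  have h6 := time_augment_le r.2 γ S.f
  have h7 := time_signLists_le vs
    (Function.update (Function.update S.exc vp (S.exc vp - γ)) vm (S.exc vm + γ))
  rw [hn] at h1 h3 h4 h7
  nlinarith

theorem mem_signLists [Fintype V] [DecidableEq V] {vs : List V} (hvs : vs.Nodup)
    (hmem : ∀ v, v ∈ vs) (exc : V → ℤ) (v : V) :
    (v ∈ (signLists vs exc).val.1 ↔ 0 < exc v) ∧ (v ∈ (signLists vs exc).val.2 ↔ exc v < 0) := by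
  let Inv : Finset V → List V × List V → Prop := fun S r =>
    ∀ v, (v ∈ r.1 ↔ v ∈ S ∧ 0 < exc v) ∧ (v ∈ r.2 ↔ v ∈ S ∧ exc v < 0)
  suffices key : Inv Finset.univ (signLists vs exc).val by simpa [Inv] using key v
  refine forEach_induction hvs hmem Inv (by simp [Inv]) ?_
  intro v S r hv ih
  simp only [val_bind, rd, less, decide_eq_true_eq]
  split
  · simp only [Inv, val_bind, push, val_pure, List.mem_cons, Finset.mem_insert]
    grind
  · split
    · simp only [Inv, val_bind, push, val_pure, List.mem_cons, Finset.mem_insert]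
      grind
    · simp only [Inv, val_pure, Finset.mem_insert]
      grind

theorem computeSupply_eq [Fintype V] [DecidableEq V] (G : Digraph V) [DecidableRel G.Adj]
    {vs : List V} (hvs : vs.Nodup) (hmem : ∀ v, v ∈ vs) (d : V × V → ℤ) :
    (computeSupply vs (adjMatrix G) d).val = supply G d := by
  simp only [computeSupply, val_bind]
  refine forEach_induction_on hvs hmem
    (fun S (b : V → ℤ) => ∀ v, b v = if v ∈ S then supply G d v else 0)
    (Q := fun b => b = supply G d) (fun b hb => funext fun v => by simpa using hb v)
    (by simp [newArray]) ?_
  intro v S b₀ hv ih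
  refine forEach_induction_on hvs hmem (fun T (b : V → ℤ) => (∀ x, x ≠ v → b x = b₀ x) ∧
      b v = (∑ u ∈ T with G.Adj v u, d (v, u)) - ∑ u ∈ T with G.Adj u v, d (u, v))
    (Q := fun b => ∀ x, b x = if x ∈ insert v S then supply G d x else 0) ?_
    (by simp [ih, hv]) ?_
  · rintro b ⟨h1, h2⟩ x
    by_cases hx : x = v
    · subst hx
      rw [h2, if_pos (Finset.mem_insert_self _ _), supply]
    · rw [h1 x hx, ih]
      simp [hx]
  · rintro u T b hu ⟨ih1, ih2⟩
    simp only [val_bind, rd, adjMatrix, decide_eq_true_eq]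
    by_cases h1 : G.Adj v u <;> by_cases h2 : G.Adj u v <;>
      simp only [h1, h2, if_true, if_false, val_bind, wr, add, sub, val_pure,
        Finset.filter_insert, Function.update_self, Function.update_idem] <;>
      refine ⟨fun x hx => by simp [hx, ih1 x hx], ?_⟩ <;>
      simp [hu, ih2] <;> ring

/-- The least reduced cost of an arc of the residual network from `e.1` to `e.2`, or `⊤` if there is
no arc. -/
def residualLength (G : Digraph V) [DecidableRel G.Adj] (f : V × V → ℤ) (pot : V → ℤ)
    (e : V × V) : WithTop ℤ :=
  if 0 < f e.swap then ((-1 - pot e.1 + pot e.2 : ℤ) : WithTop ℤ)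
  else if SymAdj G e.1 e.2 then ((1 - pot e.1 + pot e.2 : ℤ) : WithTop ℤ)
  else ⊤

theorem residualLength_mk (G : Digraph V) [DecidableRel G.Adj] (f : V × V → ℤ) (pot : V → ℤ)
    (u v : V) : residualLength G f pot (u, v) =
      if 0 < f (v, u) then ((-1 - pot u + pot v : ℤ) : WithTop ℤ)
      else if SymAdj G u v then ((1 - pot u + pot v : ℤ) : WithTop ℤ) else ⊤ :=
  rfl

theorem residualLength_le {G : Digraph V} [DecidableRel G.Adj] (f : V × V → ℤ) (pot : V → ℤ)
    {u v : V} (huv : SymAdj G u v) :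
    residualLength G f pot (u, v) ≤ ((1 - pot u + pot v : ℤ) : WithTop ℤ) := by
  rw [residualLength_mk]
  split_ifs
  · exact WithTop.coe_le_coe.2 (by omega)
  · exact le_rfl

/-- Arcs of the symmetric graph have infinite capacity, so that the residual network never loses
them and a vertex with negative supply remains in reach of one with positive supply. -/
theorem dist_ne_top {G : Digraph V} [DecidableRel G.Adj] {f : V × V → ℤ} {pot : V → ℤ}
    {δ : V → WithTop ℤ} (hδ : ∀ u v, δ v ≤ δ u + residualLength G f pot (u, v)) {u v : V}
    (huv : Relation.ReflTransGen (SymAdj G) u v) (hu : δ u ≠ ⊤) : δ v ≠ ⊤ := by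
  induction huv with
  | refl => exact hu
  | tail _ hvw ih =>
    exact ne_top_of_le_ne_top (WithTop.add_ne_top.2 ⟨ih, WithTop.coe_ne_top⟩)
      ((hδ _ _).trans (add_le_add_right (residualLength_le _ _ hvw) _))

theorem residualLengths_eq [Fintype V] [DecidableEq V] (G : Digraph V) [DecidableRel G.Adj]
    {vs : List V} (hvs : vs.Nodup) (hmem : ∀ v, v ∈ vs) (f : V × V → ℤ) (pot : V → ℤ) :
    (residualLengths vs (adjMatrix G) f pot).val = residualLength G f pot := by
  simp only [residualLengths, val_bind]
  refine forEach_induction_on hvs hmem (fun S (w : V × V → WithTop ℤ) =>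
    ∀ e : V × V, w e = if e.1 ∈ S then residualLength G f pot e else ⊤)
    (Q := fun w => w = residualLength G f pot) (fun w hw => funext fun e => by simpa using hw e)
    (by simp [newArray]) ?_
  intro u S w hu ih
  refine forEach_induction_on hvs hmem (fun T (w : V × V → WithTop ℤ) =>
    ∀ e : V × V, w e = if e.1 ∈ S ∨ e.1 = u ∧ e.2 ∈ T then residualLength G f pot e else ⊤)
    (Q := fun w => ∀ e : V × V, w e = if e.1 ∈ insert u S then residualLength G f pot e else ⊤)
    (fun w hw e => by rw [hw e]; simp [or_comm]) (by simpa using ih) ?_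
  intro v T w hv ih e
  have huv : w (u, v) = ⊤ := by rw [ih]; simp [hu, hv]
  simp only [val_bind, rd, adjMatrix, less, ← Bool.decide_or, decide_eq_true_eq]
  by_cases he : e = (u, v)
  · subst he
    by_cases h1 : G.Adj u v ∨ G.Adj v u <;> by_cases h2 : 0 < f (v, u) <;>
      simp [h1, h2, residualLength, SymAdj, wr, add, sub, huv]
  · have he' : (e.1 ∈ S ∨ e.1 = u ∧ e.2 ∈ insert v T) ↔ (e.1 ∈ S ∨ e.1 = u ∧ e.2 ∈ T) := by
      have : ¬ (e.1 = u ∧ e.2 = v) := fun h => he (Prod.ext h.1 h.2)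
      simp only [Finset.mem_insert]
      tauto
    simp only [he']
    rw [← ih e]
    by_cases h1 : G.Adj u v ∨ G.Adj v u <;> by_cases h2 : 0 < f (v, u) <;>
      simp [h1, h2, wr, add, sub, he]

theorem updatePotential_apply [Fintype V] [DecidableEq V] {vs : List V} (hvs : vs.Nodup)
    (hmem : ∀ v, v ∈ vs) (pot : V → ℤ) (δ : V → WithTop ℤ) (v : V) :
    (updatePotential vs pot δ).val v = pot v - (δ v).untopD 0 := by
  let Inv : Finset V → (V → ℤ) → Prop := fun S p =>
    ∀ v, p v = if v ∈ S then pot v - (δ v).untopD 0 else pot v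
  suffices key : Inv Finset.univ (updatePotential vs pot δ).val by simpa [Inv] using key v
  refine forEach_induction hvs hmem Inv (by simp [Inv]) ?_
  intro v S p hv ih x
  simp only [val_bind, rd]
  by_cases hx : x = v
  · subst hx
    cases h : δ x with
    | top =>
      have := ih x
      rw [if_neg hv] at this
      simpa using this
    | coe c =>
      have := ih x
      rw [if_neg hv] at this
      simp only [Finset.mem_insert_self, if_true, WithTop.untopD_coe]
      rw [← this]
      exact Function.update_self _ _ _
  · have : (x ∈ insert v S) ↔ x ∈ S := by simp [hx]
    refine Eq.trans ?_ ((ih x).trans (if_congr this.symm rfl rfl))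
    cases h : δ v with
    | top => rfl
    | coe c => exact Function.update_of_ne hx _ _

theorem bottleneck_spec (P : List (V × V)) (f : V × V → ℤ) {γ₀ : ℤ} (h0 : 0 < γ₀) :
    0 < (bottleneck P f γ₀).val ∧ (bottleneck P f γ₀).val ≤ γ₀ ∧
      ∀ e ∈ P, 0 < f e.swap → (bottleneck P f γ₀).val ≤ f e.swap := by
  unfold bottleneck
  induction P generalizing γ₀ with
  | nil => simpa [forEach] using h0
  | cons e P ih =>
    simp only [forEach, val_bind, rd, less, decide_eq_true_eq]
    split
    · rename_i he
      simp only [minimum]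
      obtain ⟨h1, h2, h3⟩ := ih (lt_min h0 he)
      refine ⟨h1, h2.trans (min_le_left _ _), fun x hx => ?_⟩
      rcases List.mem_cons.1 hx with rfl | hx
      · exact fun _ => h2.trans (min_le_right _ _)
      · exact h3 x hx
    · rename_i he
      simp only [val_pure]
      obtain ⟨h1, h2, h3⟩ := ih h0
      refine ⟨h1, h2, fun x hx => ?_⟩
      rcases List.mem_cons.1 hx with rfl | hx
      · exact fun h => absurd h he
      · exact h3 x hx

/-- The net outflow of `f` at `v`. -/
def netOutflow [Fintype V] (f : V × V → ℤ) (v : V) : ℤ := (∑ u, f (v, u)) - ∑ u, f (u, v)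

theorem netOutflow_update [Fintype V] [DecidableEq V] (f : V × V → ℤ) (x y : V) (c : ℤ) (v : V) :
    netOutflow (Function.update f (x, y) (f (x, y) + c)) v =
      netOutflow f v + (if v = x then c else 0) - if v = y then c else 0 := by
  have h : ∀ e, Function.update f (x, y) (f (x, y) + c) e =
      f e + if e.1 = x ∧ e.2 = y then c else 0 := by
    intro e
    by_cases he : e = (x, y)
    · simp [he]
    · rw [Function.update_of_ne he, if_neg fun h => he (Prod.ext h.1 h.2), add_zero]
  have h1 : ∑ u, (if v = x ∧ u = y then c else 0) = if v = x then c else 0 := by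
    by_cases hv : v = x <;> simp [hv]
  have h2 : ∑ u, (if u = x ∧ v = y then c else 0) = if v = y then c else 0 := by
    by_cases hv : v = y <;> simp [hv]
  simp only [netOutflow, h, Finset.sum_add_distrib, h1, h2]
  ring

/-- The value of `f` that decides whether an arc of `P` is a backward arc is read during the loop,
after earlier arcs have been processed. It is still the original one, because no arc occurs twice
in `P`, not even in opposite directions. -/
theorem augment_spec [Fintype V] [DecidableEq V] {P : List (V × V)} {a b : V}
    (hP : IsWalk a b P) (hsimple : P.Pairwise fun e e' => e' ≠ e ∧ e' ≠ e.swap) {γ : ℤ}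
    (hγ : 0 < γ) {f : V × V → ℤ} (hf : ∀ e, 0 ≤ f e)
    (hcap : ∀ e ∈ P, 0 < f e.swap → γ ≤ f e.swap) :
    (∀ e, 0 ≤ (augment P γ f).val e) ∧
      (∀ e, 0 < (augment P γ f).val e → 0 < f e ∨ e ∈ P ∧ ¬ 0 < f e.swap) ∧
      ∀ v, netOutflow (augment P γ f).val v =
        netOutflow f v + (if v = a then γ else 0) - if v = b then γ else 0 := by
  induction hP generalizing f with
  | nil v => exact ⟨hf, fun e he => Or.inl he, fun x => by simp [augment, forEach]⟩
  | @cons u v t P _ ih =>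
    obtain ⟨hs1, hs2⟩ := List.pairwise_cons.1 hsimple
    have hswap : ∀ e ∈ P, e.swap ≠ (u, v) ∧ e.swap ≠ (v, u) := by
      refine fun e he => ⟨fun h => (hs1 e he).2 ?_, fun h => (hs1 e he).1 ?_⟩
      · rw [← h, Prod.swap_swap]
      · rw [← Prod.swap_swap e, h, Prod.swap_prod_mk]
    by_cases hback : 0 < f (v, u)
    · have hval : (augment ((u, v) :: P) γ f).val =
          (augment P γ (Function.update f (v, u) (f (v, u) - γ))).val := by
        simp [augment, forEach, rd, less, sub, wr, hback]
      rw [hval]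
      have hsub : f (v, u) - γ = f (v, u) + -γ := sub_eq_add_neg _ _
      have hle : γ ≤ f (v, u) := hcap (u, v) List.mem_cons_self hback
      have hfix : ∀ e ∈ P, Function.update f (v, u) (f (v, u) - γ) e.swap = f e.swap :=
        fun e he => Function.update_of_ne (hswap e he).2 _ _
      obtain ⟨h1, h2, h3⟩ := ih hs2 (f := Function.update f (v, u) (f (v, u) - γ))
        (fun e => by
          by_cases he : e = (v, u)
          · simpa [he] using hle
          · simpa [he] using hf e)
        (fun e he => by
          rw [hfix e he]
          exact hcap e (List.mem_cons_of_mem _ he))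
      refine ⟨h1, fun e he => ?_, fun x => ?_⟩
      · rcases h2 e he with h | ⟨h, h'⟩
        · by_cases he' : e = (v, u)
          · exact Or.inl (he' ▸ hback)
          · rw [Function.update_of_ne he'] at h
            exact Or.inl h
        · rw [hfix e h] at h'
          exact Or.inr ⟨List.mem_cons_of_mem _ h, h'⟩
      · rw [h3, hsub, netOutflow_update]
        split_ifs <;> ring
    · have hval : (augment ((u, v) :: P) γ f).val =
          (augment P γ (Function.update f (u, v) (f (u, v) + γ))).val := by
        simp [augment, forEach, rd, less, add, wr, hback]
      rw [hval]
      have hfix : ∀ e ∈ P, Function.update f (u, v) (f (u, v) + γ) e.swap = f e.swap :=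
        fun e he => Function.update_of_ne (hswap e he).1 _ _
      obtain ⟨h1, h2, h3⟩ := ih hs2 (f := Function.update f (u, v) (f (u, v) + γ))
        (fun e => by
          by_cases he : e = (u, v)
          · simpa [he] using add_nonneg (hf (u, v)) hγ.le
          · simpa [he] using hf e)
        (fun e he => by
          rw [hfix e he]
          exact hcap e (List.mem_cons_of_mem _ he))
      refine ⟨h1, fun e he => ?_, fun x => ?_⟩
      · rcases h2 e he with h | ⟨h, h'⟩
        · by_cases he' : e = (u, v)
          · subst he'
            exact Or.inr ⟨List.mem_cons_self, hback⟩
          · rw [Function.update_of_ne he'] at h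
            exact Or.inl h
        · rw [hfix e h] at h'
          exact Or.inr ⟨List.mem_cons_of_mem _ h, h'⟩
      · rw [h3, netOutflow_update]
        split_ifs <;> ring

end Parts

/-! ### Duality -/

section Duality

theorem symAdj_comm {V : Type} (G : Digraph V) {u v : V} : SymAdj G u v ↔ SymAdj G v u := or_comm

variable {V : Type} [Fintype V] {G : Digraph V} [DecidableRel G.Adj]

theorem dualValue_eq_sum {d f : V × V → ℝ} (hf : IsFeasibleFlow G d f) (x : V → ℝ) :
    dualValue G d x = ∑ e : V × V with SymAdj G e.1 e.2, f e * (x e.1 - x e.2) := by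
  have h1 : ∑ v, (∑ u with SymAdj G v u, f (v, u)) * x v =
      ∑ e : V × V with SymAdj G e.1 e.2, f e * x e.1 := by
    simp only [Finset.sum_filter, Fintype.sum_prod_type, Finset.sum_mul, ite_mul, zero_mul]
  have h2 : ∑ v, (∑ u with SymAdj G u v, f (u, v)) * x v =
      ∑ e : V × V with SymAdj G e.1 e.2, f e * x e.2 := by
    simp only [Finset.sum_filter, Fintype.sum_prod_type, Finset.sum_mul, ite_mul, zero_mul]
    exact Finset.sum_comm
  simp only [dualValue, ← hf.1, sub_mul, mul_sub, Finset.sum_sub_distrib, h1, h2]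

/-- Weak duality. -/
theorem dualValue_le_flowCost {d f : V × V → ℝ} {x : V → ℝ} (hf : IsFeasibleFlow G d f)
    (hx : IsFeasibleDual G x) : dualValue G d x ≤ flowCost G f := by
  rw [dualValue_eq_sum hf, flowCost]
  refine Finset.sum_le_sum fun e he => ?_
  have he := (Finset.mem_filter.1 he).2
  exact mul_le_of_le_one_right (hf.2 _ _ he) (hx _ _ ((symAdj_comm G).1 he))

/-- Complementary slackness: if the dual constraint is tight wherever `f` is positive, then the two
objective values agree. -/
theorem isOptimal_of_complementary {d f : V × V → ℝ} {x : V → ℝ} (hf : IsFeasibleFlow G d f)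
    (hx : IsFeasibleDual G x) (h : ∀ u v, SymAdj G u v → 0 < f (u, v) → 1 ≤ x u - x v) :
    IsOptimalFlow G d f ∧ IsOptimalDual G d x := by
  have heq : dualValue G d x = flowCost G f := by
    refine (dualValue_le_flowCost hf hx).antisymm ?_
    rw [dualValue_eq_sum hf, flowCost]
    refine Finset.sum_le_sum fun e he => ?_
    have he := (Finset.mem_filter.1 he).2
    rcases (hf.2 _ _ he).eq_or_lt with h0 | hpos
    · rw [← h0, zero_mul]
    · exact le_mul_of_one_le_right hpos.le (h _ _ he hpos)
  exact ⟨⟨hf, fun g hg => heq ▸ dualValue_le_flowCost hg hx⟩,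
    ⟨hx, fun y hy => heq ▸ dualValue_le_flowCost hf hy⟩⟩

end Duality

/-! ### The invariant of the flow algorithm -/

section Invariant

variable {V : Type} [Fintype V] {G : Digraph V} [DecidableRel G.Adj] {d : V × V → ℤ}

theorem sum_netOutflow (f : V × V → ℤ) : ∑ v, netOutflow f v = 0 := by
  simp only [netOutflow, Finset.sum_sub_distrib]
  rw [sub_eq_zero]
  exact Finset.sum_comm

theorem sum_supply (d : V × V → ℤ) : ∑ v, supply G d v = 0 := by
  simp only [supply, Finset.sum_sub_distrib, Finset.sum_filter]
  rw [sub_eq_zero]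
  exact Finset.sum_comm

/-- The invariant of the flow algorithm: `f` is a nonnegative flow that, together with the
remaining supply, meets the supply `b^d`, and the reduced costs of all residual arcs are
nonnegative. -/
structure FlowInvariant (G : Digraph V) [DecidableRel G.Adj] (d : V × V → ℤ)
    (S : FlowState V) : Prop where
  flow_nonneg : ∀ e, 0 ≤ S.f e
  symAdj_of_pos : ∀ u v, 0 < S.f (u, v) → SymAdj G u v
  balance : ∀ v, netOutflow S.f v + S.exc v = supply G d v
  pot_sub_le : ∀ u v, SymAdj G u v → S.pot u - S.pot v ≤ 1
  le_pot_sub : ∀ u v, 0 < S.f (u, v) → 1 ≤ S.pot u - S.pot v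
  mem_excPos : ∀ v, v ∈ S.excPos ↔ 0 < S.exc v
  mem_excNeg : ∀ v, v ∈ S.excNeg ↔ S.exc v < 0

theorem flowInvariant_initialStep [DecidableEq V] {vs : List V} (hvs : vs.Nodup)
    (hmem : ∀ v, v ∈ vs) : FlowInvariant G d (initialStep vs (adjMatrix G) d).val ∧
      (initialStep vs (adjMatrix G) d).val.exc = supply G d := by
  have hexc := computeSupply_eq G hvs hmem d
  refine ⟨⟨?_, ?_, ?_, ?_, ?_, ?_, ?_⟩, hexc⟩ <;>
    simp only [initialStep, val_bind, newArray, val_pure, hexc]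
  · simp
  · simp
  · simp [netOutflow]
  · simp
  · simp
  · exact fun v => (mem_signLists hvs hmem _ v).1
  · exact fun v => (mem_signLists hvs hmem _ v).2

namespace FlowInvariant

variable {S : FlowState V}

theorem sum_exc (h : FlowInvariant G d S) : ∑ v, S.exc v = 0 := by
  have h1 : ∑ v, (netOutflow S.f v + S.exc v) = ∑ v, supply G d v :=
    Finset.sum_congr rfl fun v _ => h.balance v
  rwa [Finset.sum_add_distrib, sum_netOutflow, sum_supply, zero_add] at h1

theorem eq_zero_of_not_symAdj (h : FlowInvariant G d S) {u v : V} (huv : ¬ SymAdj G u v) :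
    S.f (u, v) = 0 :=
  le_antisymm (not_lt.1 fun hpos => huv (h.symAdj_of_pos u v hpos)) (h.flow_nonneg _)

/-- At an isolated vertex there is neither supply nor flow, so that nothing remains to be sent. -/
theorem exists_symAdj (h : FlowInvariant G d S) {v : V} (hv : S.exc v ≠ 0) :
    ∃ u, SymAdj G v u := by
  by_contra! hno
  have hout : ∀ u, S.f (v, u) = 0 := fun u => h.eq_zero_of_not_symAdj (hno u)
  have hin : ∀ u, S.f (u, v) = 0 :=
    fun u => h.eq_zero_of_not_symAdj fun hu => hno u ((symAdj_comm G).1 hu)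
  have h1 := h.balance v
  have h2 : supply G d v = 0 := by
    simp [supply, fun u => show ¬ G.Adj v u from fun hu => hno u (Or.inl hu),
      fun u => show ¬ G.Adj u v from fun hu => hno u (Or.inr hu)]
  simp only [netOutflow, hout, hin, h2] at h1
  simp at h1
  exact hv h1

theorem excNeg_ne_nil (h : FlowInvariant G d S) (hpos : S.excPos ≠ []) : S.excNeg ≠ [] := by
  intro hneg
  obtain ⟨v, hv⟩ := List.exists_mem_of_ne_nil _ hpos
  have hnn : ∀ u, 0 ≤ S.exc u := by
    intro u
    by_contra! hu
    simpa [hneg] using (h.mem_excNeg u).2 hu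
  have := Finset.sum_pos' (fun u _ => hnn u) ⟨v, Finset.mem_univ v, (h.mem_excPos v).1 hv⟩
  exact this.ne' h.sum_exc

theorem exc_eq_zero (h : FlowInvariant G d S) (hpos : S.excPos = []) (v : V) : S.exc v = 0 := by
  have hnp : ∀ u ∈ Finset.univ, S.exc u ≤ 0 := by
    intro u _
    by_contra! hu
    simpa [hpos] using (h.mem_excPos u).2 hu
  exact (Finset.sum_eq_zero_iff_of_nonpos hnp).1 h.sum_exc v (Finset.mem_univ v)

theorem isOptimal (h : FlowInvariant G d S) (hpos : S.excPos = []) :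
    IsOptimalFlow G (fun e => (d e : ℝ)) (fun e => (S.f e : ℝ)) ∧
      IsOptimalDual G (fun e => (d e : ℝ)) (fun v => (S.pot v : ℝ)) := by
  refine isOptimal_of_complementary ⟨fun v => ?_, fun u v _ => ?_⟩ (fun u v huv => ?_)
    fun u v _ huv => ?_
  · have h1 := h.balance v
    rw [h.exc_eq_zero hpos, add_zero, netOutflow] at h1
    have h2 : ∑ u, S.f (v, u) = ∑ u with SymAdj G v u, S.f (v, u) := by
      refine (Finset.sum_filter_of_ne fun u _ hu => ?_).symm
      by_contra hno
      exact hu (h.eq_zero_of_not_symAdj hno)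
    have h3 : ∑ u, S.f (u, v) = ∑ u with SymAdj G u v, S.f (u, v) := by
      refine (Finset.sum_filter_of_ne fun u _ hu => ?_).symm
      by_contra hno
      exact hu (h.eq_zero_of_not_symAdj hno)
    rw [h2, h3, supply] at h1
    simp only [supply]
    exact_mod_cast h1
  · exact Int.cast_nonneg (h.flow_nonneg (u, v))
  · exact_mod_cast h.pot_sub_le v u ((symAdj_comm G).1 huv)
  · exact_mod_cast h.le_pot_sub u v (by exact_mod_cast huv)

theorem residualLength_nonneg (h : FlowInvariant G d S) (e : V × V) :
    0 ≤ residualLength G S.f S.pot e := by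
  obtain ⟨u, v⟩ := e
  rw [residualLength_mk]
  split_ifs with h1 h2
  · have := h.le_pot_sub v u h1
    exact WithTop.coe_nonneg.2 (by omega)
  · have := h.pot_sub_le u v h2
    exact WithTop.coe_nonneg.2 (by omega)
  · exact le_top

/-- Subtracting the distances from the potentials keeps the reduced costs nonnegative, and the
reduced costs on shortest paths become `0`. The distances of adjacent vertices are both finite or
both infinite. -/
theorem pot_sub_dist (h : FlowInvariant G d S) {δ : V → WithTop ℤ}
    (hδ : ∀ u v, δ v ≤ δ u + residualLength G S.f S.pot (u, v)) :
    (∀ u v, SymAdj G u v →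
      (S.pot u - (δ u).untopD 0) - (S.pot v - (δ v).untopD 0) ≤ 1) ∧
    (∀ u v, 0 < S.f (u, v) →
      1 ≤ (S.pot u - (δ u).untopD 0) - (S.pot v - (δ v).untopD 0)) ∧
    ∀ u v, ¬ 0 < S.f (v, u) → IsTight (residualLength G S.f S.pot) δ (u, v) →
      SymAdj G u v ∧ 1 ≤ (S.pot u - (δ u).untopD 0) - (S.pot v - (δ v).untopD 0) := by
  have hle : ∀ u v, SymAdj G u v → δ v ≤ δ u + ((1 - S.pot u + S.pot v : ℤ) : WithTop ℤ) :=
    fun u v huv => (hδ u v).trans (add_le_add_right (residualLength_le _ _ huv) _)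
  have htop : ∀ u v, SymAdj G u v → δ v = ⊤ → δ u = ⊤ := by
    intro u v huv hv
    have := hle u v huv
    rw [hv, top_le_iff, WithTop.add_eq_top] at this
    exact this.resolve_right (WithTop.coe_ne_top)
  have hboth : ∀ u v, SymAdj G u v →
      δ u = ⊤ ∧ δ v = ⊤ ∨ ∃ a b : ℤ, δ u = a ∧ δ v = b := by
    intro u v huv
    cases hu : δ u with
    | top => exact Or.inl ⟨rfl, htop v u ((symAdj_comm G).1 huv) hu⟩
    | coe a =>
      cases hv : δ v with
      | top => exact absurd (htop u v huv hv) (by simp [hu])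
      | coe b => exact Or.inr ⟨a, b, rfl, rfl⟩
  refine ⟨fun u v huv => ?_, fun u v huv => ?_, fun u v hback ⟨hfin, htight⟩ => ?_⟩
  · have h1 := h.pot_sub_le u v huv
    rcases hboth u v huv with ⟨ha, hb⟩ | ⟨a, b, ha, hb⟩
    · simpa [ha, hb] using h1
    · have h2 := hle u v huv
      rw [ha, hb, ← WithTop.coe_add, WithTop.coe_le_coe] at h2
      simp only [ha, hb, WithTop.untopD_coe]
      omega
  · have h1 := h.le_pot_sub u v huv
    rcases hboth u v (h.symAdj_of_pos u v huv) with ⟨ha, hb⟩ | ⟨a, b, ha, hb⟩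
    · simpa [ha, hb] using h1
    · have h2 := hδ v u
      rw [residualLength_mk, if_pos huv, ha, hb, ← WithTop.coe_add, WithTop.coe_le_coe] at h2
      simp only [ha, hb, WithTop.untopD_coe]
      omega
  · have huv : SymAdj G u v := by
      by_contra huv
      apply hfin
      rw [htight, residualLength_mk, if_neg hback, if_neg huv]
      exact WithTop.add_top _
    refine ⟨huv, ?_⟩
    rcases hboth u v huv with ⟨ha, hb⟩ | ⟨a, b, ha, hb⟩
    · exact absurd hb hfin
    · simp only at htight
      rw [residualLength_mk, if_neg hback, if_pos huv, ha, hb, ← WithTop.coe_add,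
        WithTop.coe_inj] at htight
      simp only [ha, hb, WithTop.untopD_coe]
      omega

/-- An iteration keeps the invariant and decreases the total amount of the remaining supplies. -/
theorem iteration [DecidableEq V] (h : FlowInvariant G d S)
    (hconn : ∀ u v, (∃ x, SymAdj G u x) → (∃ x, SymAdj G v x) →
      Relation.ReflTransGen (SymAdj G) u v)
    {vs : List V} (hvs : vs.Nodup) (hmem : ∀ v, v ∈ vs) {vp vm : V} (hvp : vp ∈ S.excPos)
    (hvm : vm ∈ S.excNeg) :
    FlowInvariant G d (iteration vs (adjMatrix G) S vp vm).val ∧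
      ∑ v, |(SubdivisionFlow.iteration vs (adjMatrix G) S vp vm).val.exc v| + 2 ≤
        ∑ v, |S.exc v| := by
  rw [h.mem_excPos] at hvp
  rw [h.mem_excNeg] at hvm
  set w := (residualLengths vs (adjMatrix G) S.f S.pot).val
  have hw : w = residualLength G S.f S.pot := residualLengths_eq G hvs hmem _ _
  obtain ⟨hs, hδ, hpath⟩ := dijkstra_spec hvs hmem (hw ▸ h.residualLength_nonneg) vp vm
  set r := (dijkstra vs w vp vm).val
  rw [hw] at hδ hpath
  obtain ⟨hwalk, htight, hsimple⟩ := hpath (dist_ne_top hδ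
    (hconn vp vm (h.exists_symAdj hvp.ne') (h.exists_symAdj hvm.ne)) (by simp [hs]))
  -- the supplies are integral, so that at least one unit is sent
  obtain ⟨hγ, hγ₀, hcap⟩ := bottleneck_spec r.2 S.f
    (lt_min hvp (show 0 < 0 - S.exc vm by omega))
  set γ := (bottleneck r.2 S.f (min (S.exc vp) (0 - S.exc vm))).val
  obtain ⟨hf1, hf2, hf3⟩ := augment_spec hwalk hsimple hγ h.flow_nonneg hcap
  set exc' := Function.update (Function.update S.exc vp (S.exc vp - γ)) vm (S.exc vm + γ)
  have hval : (SubdivisionFlow.iteration vs (adjMatrix G) S vp vm).val =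
      ⟨(augment r.2 γ S.f).val, (updatePotential vs S.pot r.1).val, exc',
        (signLists vs exc').val.1, (signLists vs exc').val.2⟩ := rfl
  have hne : vp ≠ vm := fun heq => by rw [heq] at hvp; omega
  have hexc : ∀ v, exc' v =
      S.exc v - (if v = vp then γ else 0) + if v = vm then γ else 0 := by
    intro v
    by_cases h1 : v = vm
    · subst h1
      simp [exc', hne.symm]
    · by_cases h2 : v = vp
      · subst h2
        simp [exc', hne]
      · simp [exc', h1, h2]
  obtain ⟨hp1, hp2, hp3⟩ := h.pot_sub_dist hδ
  rw [hval]
  refine ⟨⟨hf1, fun u v huv => ?_, fun v => ?_, fun u v huv => ?_, fun u v huv => ?_,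
    fun v => (mem_signLists hvs hmem _ v).1, fun v => (mem_signLists hvs hmem _ v).2⟩, ?_⟩
  · rcases hf2 _ huv with h1 | ⟨h1, h2⟩
    · exact h.symAdj_of_pos u v h1
    · exact (hp3 u v h2 (htight _ h1)).1
  · simp only [hf3, hexc, ← h.balance v]
    ring
  · simp only [updatePotential_apply hvs hmem]
    exact hp1 u v huv
  · simp only [updatePotential_apply hvs hmem]
    rcases hf2 _ huv with h1 | ⟨h1, h2⟩
    · exact hp2 u v h1
    · exact (hp3 u v h2 (htight _ h1)).2
  · have habs : ∀ v, |exc' v| =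
        |S.exc v| - (if v = vp then γ else 0) - if v = vm then γ else 0 := by
      have h1 : γ ≤ S.exc vp := hγ₀.trans (min_le_left _ _)
      have h2 : γ ≤ 0 - S.exc vm := hγ₀.trans (min_le_right _ _)
      intro v
      rw [hexc]
      by_cases hm : v = vm
      · subst hm
        rw [if_neg hne.symm, if_pos rfl, abs_of_neg hvm, abs_of_nonpos (by omega)]
        ring
      · by_cases hp : v = vp
        · subst hp
          rw [if_neg hne, if_pos rfl, abs_of_pos hvp, abs_of_nonneg (by omega)]
          ring
        · simp [hm, hp]
    simp only [habs, Finset.sum_sub_distrib, Finset.sum_ite_eq', Finset.mem_univ, if_true]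
    omega

end FlowInvariant

/-- The sum of the absolute values of the remaining supplies bounds the number of iterations: it is
at most `2B` at the beginning, and every iteration decreases it by at least `2`. -/
theorem Run.invariant [DecidableEq V] [Nonempty V]
    (hconn : ∀ u v, (∃ x, SymAdj G u x) → (∃ x, SymAdj G v x) →
      Relation.ReflTransGen (SymAdj G) u v)
    {vs : List V} (hvs : vs.Nodup) (hmem : ∀ v, v ∈ vs) {S : FlowState V} {k t : ℕ}
    (hrun : Run vs (adjMatrix G) d S k t) :
    FlowInvariant G d S ∧ ∑ v, |S.exc v| + 2 * k ≤ ∑ v, |supply G d v| ∧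
      t ≤ 69 * Fintype.card V ^ 2 * (k + 1) := by
  induction hrun with
  | init =>
    obtain ⟨h1, h2⟩ := flowInvariant_initialStep (G := G) (d := d) hvs hmem
    refine ⟨h1, by simp [h2], ?_⟩
    simpa using time_initialStep_le hvs hmem (adjMatrix G) d
  | @step S _ _ _ _ _ hstep ih =>
    obtain ⟨vp, hvp, vm, hvm, rfl, rfl⟩ := hstep
    obtain ⟨h1, h2, h3⟩ := ih
    obtain ⟨g1, g2⟩ := h1.iteration hconn hvs hmem hvp hvm
    have g3 := time_iteration_le hvs hmem (adjMatrix G) S vp vm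
    refine ⟨g1, ?_, ?_⟩
    · push_cast
      omega
    · rw [mul_add_one]
      exact Nat.add_le_add h3 g3

/-- The analysis of the flow algorithm needs nothing of the grid graph but that its non-isolated
vertices are connected. -/
theorem flow_algorithm [DecidableEq V] [Nonempty V]
    (hconn : ∀ u v, (∃ x, SymAdj G u x) → (∃ x, SymAdj G v x) →
      Relation.ReflTransGen (SymAdj G) u v)
    {vs : List V} (hvs : vs.Nodup) (hmem : ∀ v, v ∈ vs) {B : ℝ}
    (hB : B = 1 / 2 * ∑ v, |supply G (fun e => (d e : ℝ)) v|) {S : FlowState V} {k t : ℕ}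
    (hrun : Run vs (adjMatrix G) d S k t) :
    (k : ℝ) ≤ B ∧ (t : ℝ) ≤ (138 : ℕ) * max B 1 * (Fintype.card V : ℝ) ^ 2 ∧
      (S.excPos ≠ [] → ∃ S' c, Step vs (adjMatrix G) S S' c) ∧
      (S.excPos = [] →
        IsOptimalFlow G (fun e => (d e : ℝ)) (fun e => (S.f e : ℝ)) ∧
        IsOptimalDual G (fun e => (d e : ℝ)) (fun v => (S.pot v : ℝ))) := by
  obtain ⟨h1, h2, h3⟩ := Run.invariant hconn hvs hmem hrun
  have hB' : B = 1 / 2 * ((∑ v, |supply G d v| : ℤ) : ℝ) := by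
    rw [hB]
    simp [supply]
  have hk : (k : ℝ) ≤ B := by
    have h4 : (0 : ℤ) ≤ ∑ v, |S.exc v| := Finset.sum_nonneg fun v _ => abs_nonneg _
    have h5 : (2 * k : ℤ) ≤ ∑ v, |supply G d v| := by omega
    have h6 : (2 * k : ℝ) ≤ ((∑ v, |supply G d v| : ℤ) : ℝ) := by exact_mod_cast h5
    rw [hB']
    linarith
  refine ⟨hk, ?_, fun hpos => ?_, h1.isOptimal⟩
  · have h4 : (t : ℝ) ≤ 69 * (Fintype.card V : ℝ) ^ 2 * (k + 1) := by exact_mod_cast h3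
    have h5 : (k : ℝ) + 1 ≤ 2 * max B 1 := by
      have := le_max_left B 1
      have := le_max_right B 1
      linarith
    calc (t : ℝ) ≤ 69 * (Fintype.card V : ℝ) ^ 2 * (k + 1) := h4
      _ ≤ 69 * (Fintype.card V : ℝ) ^ 2 * (2 * max B 1) := by gcongr
      _ = (138 : ℕ) * max B 1 * (Fintype.card V : ℝ) ^ 2 := by push_cast; ring
  · obtain ⟨vp, hvp⟩ := List.exists_mem_of_ne_nil _ hpos
    obtain ⟨vm, hvm⟩ := List.exists_mem_of_ne_nil _ (h1.excNeg_ne_nil hpos)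
    exact ⟨_, _, vp, hvp, vm, hvm, rfl, rfl⟩

end Invariant

/-! ### Connectivity of the grid graph -/

section Grid

variable {s N : ℕ}

/-- The vertex `0`. -/
def origin (s N : ℕ) : Vertex s N := fun _ => ⟨0, Finset.mem_Icc.2 ⟨by omega, le_rfl⟩⟩

instance : Nonempty (Vertex s N) := ⟨origin s N⟩

/-- As long as a coordinate is negative, it can be increased along an edge. -/
theorem reflTransGen_origin (u : Vertex s N) (hu : ∀ i, -(N : ℤ) - 1 ≤ (u i : ℤ)) :
    Relation.ReflTransGen (SymAdj (gridGraph s N)) u (origin s N) := by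
  induction hm : (∑ i, (u i : ℤ)).natAbs using Nat.strong_induction_on generalizing u with
  | _ m ih =>
    have hle : ∀ i, (u i : ℤ) ≤ 0 := fun i => (Finset.mem_Icc.1 (u i).2).2
    by_cases h0 : ∀ i, (u i : ℤ) = 0
    · have : u = origin s N := funext fun i => Subtype.ext (h0 i)
      rw [this]
    · obtain ⟨ℓ, hℓ⟩ := not_forall.1 h0
      have hℓ' := lt_of_le_of_ne (hle ℓ) hℓ
      have hv : ∀ i, (u i : ℤ) + (if i = ℓ then 1 else 0) ∈ Finset.Icc (-(N : ℤ) - 2) 0 := by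
        intro i
        have h1 := hu i
        have h2 := hle i
        rw [Finset.mem_Icc]
        split_ifs with hi
        · subst hi
          omega
        · omega
      let v : Vertex s N := fun i => ⟨(u i : ℤ) + if i = ℓ then 1 else 0, hv i⟩
      have hvi : ∀ i, (v i : ℤ) = (u i : ℤ) + if i = ℓ then 1 else 0 := fun i => rfl
      have hv' : ∀ i, -(N : ℤ) - 1 ≤ (v i : ℤ) := by
        intro i
        have h1 := hu i
        rw [hvi]
        split_ifs <;> omega
      have hadj : SymAdj (gridGraph s N) u v :=
        Or.inr ⟨hv', ℓ, fun i => by rw [hvi]; ring⟩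
      refine Relation.ReflTransGen.head hadj (ih _ ?_ v hv' rfl)
      have hsum : ∑ i, (v i : ℤ) = ∑ i, (u i : ℤ) + 1 := by
        simp [hvi, Finset.sum_add_distrib]
      have hneg : ∑ i, (u i : ℤ) < 0 :=
        Finset.sum_neg' (fun i _ => hle i) ⟨ℓ, Finset.mem_univ ℓ, hℓ'⟩
      omega

/-- Vertices with more than one coordinate `-N-2` are isolated; all others are connected to `0`. -/
theorem gridGraph_connected (u v : Vertex s N) (hu : ∃ x, SymAdj (gridGraph s N) u x)
    (hv : ∃ x, SymAdj (gridGraph s N) v x) :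
    Relation.ReflTransGen (SymAdj (gridGraph s N)) u v := by
  have key : ∀ u : Vertex s N, (∃ x, SymAdj (gridGraph s N) u x) →
      Relation.ReflTransGen (SymAdj (gridGraph s N)) u (origin s N) := by
    rintro u ⟨x, h | h⟩
    · exact reflTransGen_origin u h.1
    · exact Relation.ReflTransGen.head (Or.inr h) (reflTransGen_origin x h.1)
  refine (key u hu).trans ?_
  have : Std.Symm (SymAdj (gridGraph s N)) := ⟨fun _ _ h => (symAdj_comm _).1 h⟩
  exact Std.Symm.symm _ _ (key v hv)

end Grid

end SubdivisionFlow

open SubdivisionFlow in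
theorem mainTheorem6 :
    -- Dijkstra's algorithm solves the shortest path problem with nonnegative costs in time `O(n²)`
    (∃ C : ℕ, ∀ (V R : Type) [Fintype V] [DecidableEq V] [AddCommGroup R] [LinearOrder R]
      [IsOrderedAddMonoid R] (vs : List V), vs.Nodup → (∀ v, v ∈ vs) →
      ∀ w : V × V → WithTop R, (∀ e, 0 ≤ w e) → ∀ s t : V,
        (∀ v, IsDistance w s v ((dijkstra vs w s t).val.1 v)) ∧
        ((dijkstra vs w s t).val.1 t ≠ ⊤ →
          IsWalk s t (dijkstra vs w s t).val.2 ∧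
            ((dijkstra vs w s t).val.2.map w).sum = (dijkstra vs w s t).val.1 t) ∧
        (dijkstra vs w s t).time ≤ C * Fintype.card V ^ 2) ∧
    -- the flow algorithm
    (∃ C : ℕ, ∀ (s N : ℕ) (d : Vertex s N × Vertex s N → ℤ) (vs : List (Vertex s N)),
      vs.Nodup → (∀ v, v ∈ vs) →
      ∀ B : ℝ, B = 1 / 2 * ∑ v, |supply (gridGraph s N) (fun e => (d e : ℝ)) v| →
      ∀ (S : FlowState (Vertex s N)) (k t : ℕ),
        Run vs (adjMatrix (gridGraph s N)) d S k t →
          (k : ℝ) ≤ B ∧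
          (t : ℝ) ≤ C * max B 1 * (Fintype.card (Vertex s N) : ℝ) ^ 2 ∧
          (S.excPos ≠ [] → ∃ S' c, Step vs (adjMatrix (gridGraph s N)) S S' c) ∧
          (S.excPos = [] →
            IsOptimalFlow (gridGraph s N) (fun e => (d e : ℝ)) (fun e => (S.f e : ℝ)) ∧
            IsOptimalDual (gridGraph s N) (fun e => (d e : ℝ)) (fun v => (S.pot v : ℝ)))) := by
  refine ⟨⟨23, fun V R _ _ _ _ _ vs hvs hmem w hw s t =>
    ⟨fun v => dijkstra_isDistance hvs hmem hw s t v, fun ht => dijkstra_path hvs hmem hw ht,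
      time_dijkstra_le hvs hmem w s t⟩⟩, 138, fun s N d vs hvs hmem B hB S k t hrun => ?_⟩
  exact flow_algorithm gridGraph_connected hvs hmem hB hrun
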